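/- Let $A\in\mathbb C^{n\times n}$, let $N\ge 1$, and let $z_1,\dots,z_N\in\mathbb C$ be arbitrary, possibly repeated, points. Let $f$ be analytic on an open set containing the convex hull of $\sigma(A)\cup\{z_1,\dots,z_N\}$, where $\sigma(A)$ is the spectrum of $A$. Let $u,v$ be polynomials with $\deg u\le N-1$, with $v(z_k)\neq0$ for $k=1,\dots,N$ and $v(\lambda)\ne0$ for all $\lambda\in\sigma(A)$, and suppose that $r=u/v$ interpolates $f$ at $z_1,\dots,z_N$ counted with multiplicities: for every $k$, $$r^{(j)}(z_k)=f^{(j)}(z_k),\qquad j=0,1,\dots,n_k-1,$$ where $n_k$ is the number of indices $i$ with $z_i=z_k$. Put $\Omega(z)=\prod_{k=1}^N(z-z_k)$. For a function $g$ analytic in a neighbourhood of the spectrum of a matrix $B$, let $$g(B)=\frac1{2\pi i}\int_\Gamma g(\lambda)(\lambda\mathbf 1-B)^{-1}\,d\lambda,$$ where the contour $\Gamma$ encloses the spectrum of $B$ (for instance, $\Gamma$ is the positively oriented boundary of a finite union of disjoint closed discs whose interiors cover the spectrum of $B$ and on which $g$ is analytic). Then $v(A)$ is invertible, and for all $b,d\in\mathbb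 C^n$ the maximum below is attained and $$\bigl|d^H\bigl(f(A)-r(A)\bigr)b\bigr|\le\max_{\substack{t\in[0,1]\\ \mu\in\operatorname{co}\{z_1,\dots,z_N\}}}\left|d^H\left[\Omega(A)[v(A)]^{-1}\frac{(vf)^{(N)}\bigl((1-t)\mu\mathbf 1+tA\bigr)}{N!}\right]b\right|,$$ where $\operatorname{co}$ denotes the convex hull and $d^H$ the conjugate transpose of $d$. -/

import Mathlib

open scoped Matrix

/-- The finite family `Γ` of circles (pairs of a centre and a radius) is a contour, made of the
positively oriented boundaries of pairwise disjoint closed discs, that encloses the spectrum of `A`;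
the function `f` is analytic on (a neighbourhood of) the closed discs that the contour surrounds. -/
structure EnclosesSpectrum {n : ℕ} (Γ : Finset (ℂ × ℝ)) (f : ℂ → ℂ)
    (A : Matrix (Fin n) (Fin n) ℂ) : Prop where
  radius_pos : ∀ p ∈ Γ, 0 < p.2
  disjoint : ∀ p ∈ Γ, ∀ q ∈ Γ, p ≠ q →
    Disjoint (Metric.closedBall p.1 p.2) (Metric.closedBall q.1 q.2)
  analytic : ∀ p ∈ Γ, AnalyticOnNhd ℂ f (Metric.closedBall p.1 p.2)
  encloses : ∀ l ∈ spectrum ℂ A, ∃ p ∈ Γ, l ∈ Metric.ball p.1 p.2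

/-- The matrix `(2πi)⁻¹ ∫_Γ f(z) (z 1 - A)⁻¹ dz`, the integral being taken entrywise over the
circles of `Γ`. -/
noncomputable def resolventIntegral {n : ℕ} (Γ : Finset (ℂ × ℝ)) (f : ℂ → ℂ)
    (A : Matrix (Fin n) (Fin n) ℂ) : Matrix (Fin n) (Fin n) ℂ :=
  Matrix.of fun i j =>
    (2 * Real.pi * Complex.I : ℂ)⁻¹ *
      ∑ p ∈ Γ, ∮ z in C(p.1, p.2),
        f z * (z • (1 : Matrix (Fin n) (Fin n) ℂ) - A)⁻¹ i j

open Classical in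
/-- The function `f` applied to the matrix `A`: the Cauchy integral of `f` against the resolvent
of `A` over a contour that encloses the spectrum of `A`. Such a contour exists whenever `f` is
analytic in a neighbourhood of the spectrum (take small circles around the eigenvalues), and the
integral does not depend on it; the value is `0` if there is none. -/
noncomputable def matrixFunction {n : ℕ} (f : ℂ → ℂ) (A : Matrix (Fin n) (Fin n) ℂ) :
    Matrix (Fin n) (Fin n) ℂ :=
  if h : ∃ Γ : Finset (ℂ × ℝ), EnclosesSpectrum Γ f A then resolventIntegral h.choose f A else 0

/-- The multiplicity of `w` in the list of points `z`. -/
noncomputable def nodeMultiplicity {N : ℕ} (z : Fin N → ℂ) (w : ℂ) : ℕ :=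
  Nat.card {i : Fin N // z i = w}

/-- The function `r` interpolates `f` at the points `z 0, …, z (N - 1)`, counted with
multiplicities. -/
def Interpolates {N : ℕ} (r f : ℂ → ℂ) (z : Fin N → ℂ) : Prop :=
  ∀ k : Fin N, ∀ j < nodeMultiplicity z (z k), iteratedDeriv j r (z k) = iteratedDeriv j f (z k)

/-- The rational function `u / v`. -/
noncomputable def ratioFun (u v : Polynomial ℂ) : ℂ → ℂ := fun w => u.eval w / v.eval w

/-- The node polynomial `Ω(w) = ∏ₖ (w - zₖ)`. -/
noncomputable def nodePolynomial {N : ℕ} (z : Fin N → ℂ) : Polynomial ℂ :=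
  ∏ k : Fin N, (Polynomial.X - Polynomial.C (z k))

/-- The number `dᴴ X b`. -/
def sandwich {n : ℕ} (d : Fin n → ℂ) (X : Matrix (Fin n) (Fin n) ℂ) (b : Fin n → ℂ) : ℂ :=
  star d ⬝ᵥ (X *ᵥ b)

/-- The matrix `Ω(A) v(A)⁻¹ (v f)^(N)((1 - t) μ 1 + t A) / N!`. -/
noncomputable def remainderMatrix {n N : ℕ} (A : Matrix (Fin n) (Fin n) ℂ) (z : Fin N → ℂ)
    (f : ℂ → ℂ) (v : Polynomial ℂ) (t : ℝ) (μ : ℂ) : Matrix (Fin n) (Fin n) ℂ :=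
  Polynomial.aeval A (nodePolynomial z) * (Polynomial.aeval A v)⁻¹ *
    ((N.factorial : ℂ)⁻¹ •
      matrixFunction (iteratedDeriv N (fun w => v.eval w * f w))
        (((1 - (t : ℂ)) * μ) • (1 : Matrix (Fin n) (Fin n) ℂ) + (t : ℂ) • A))

/-! The function φ = v f - u vanishes at the nodes with multiplicity, so φ = Ω G with G analytic,
and f(A) - r(A) = Ω(A) v(A)⁻¹ G(A). It remains to bound ℓ(G(A)) for the linear functional ℓ(X) = dᴴ
Ω(A) v(A)⁻¹ X b. If φ = (z - c) g, then x^(k+1) g⁽ᵏ⁾(c + x(w - c)) has x-derivative x^k φ⁽ᵏ⁺¹⁾(c +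
x(w - c)), so passing from φ⁽ᵏ⁺¹⁾ to g⁽ᵏ⁾ costs a factor 1/(k+1) (`norm_jetSum_iteratedDeriv_le`).
Dividing out the nodes one at a time (`exists_quotient_norm_jetSum_le`) gives the Hermite–Genocchi
bound with 1/N! and arguments (1-t)μ + tA. Since deg u < N, φ and v f have the same N-th derivative.

To make this scalar calculus, `IsSpectralResolution.matrixFunction_affine` writes g(κ + τA) as a
finite sum of derivatives of g at the points κ + τs, with coefficients independent of g, κ and τ. -/

/-! ### Cauchy's formula for derivatives on a circle -/

-- Integration by parts: f(z) (z - w)^-(j+1) is single-valued on the circle, so its derivative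
-- integrates to zero.
open Metric in
theorem circleIntegral_mul_inv_pow_succ {f : ℂ → ℂ} {c w : ℂ} {R : ℝ} (hR : 0 < R)
    (hf : AnalyticOnNhd ℂ f (closedBall c R)) (hw : w ∉ sphere c R) (j : ℕ) :
    (∮ z in C(c, R), f z * ((z - w) ^ (j + 2))⁻¹) =
      ((j : ℂ) + 1)⁻¹ * ∮ z in C(c, R), deriv f z * ((z - w) ^ (j + 1))⁻¹ := by
  have hne : ∀ z ∈ sphere c R, z - w ≠ 0 := fun z hz h => hw (sub_eq_zero.mp h ▸ hz)
  have hfs : ContinuousOn f (sphere c R) := hf.continuousOn.mono sphere_subset_closedBall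
  have hdfs : ContinuousOn (deriv f) (sphere c R) :=
    hf.deriv.continuousOn.mono sphere_subset_closedBall
  have hpow : ∀ m : ℕ, ContinuousOn (fun z => ((z - w) ^ m)⁻¹) (sphere c R) := fun m =>
    ContinuousOn.inv₀ (by fun_prop) fun z hz => pow_ne_zero _ (hne z hz)
  have key : (∮ z in C(c, R), (deriv f z * ((z - w) ^ (j + 1))⁻¹ -
      ((j : ℂ) + 1) * (f z * ((z - w) ^ (j + 2))⁻¹))) = 0 := by
    apply circleIntegral.integral_eq_zero_of_hasDerivWithinAt hR.le
      (f := fun z => f z * ((z - w) ^ (j + 1))⁻¹)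
    intro z hz
    have h0 := hne z hz
    have h1 := (hf z (sphere_subset_closedBall hz)).differentiableAt.hasDerivAt
    have h2 := (((hasDerivAt_id z).sub_const w).pow (j + 1)).inv (pow_ne_zero _ h0)
    refine ((h1.mul h2).congr_deriv ?_).hasDerivWithinAt
    simp only [id, Pi.pow_apply, Pi.inv_apply, Nat.add_sub_cancel]
    push_cast
    field_simp
    ring
  rw [circleIntegral.integral_sub, circleIntegral.integral_const_mul, sub_eq_zero] at key
  · rw [key, inv_mul_cancel_left₀ (Nat.cast_add_one_ne_zero j)]
  · exact (hdfs.mul (hpow _)).circleIntegrable hR.le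
  · exact (continuousOn_const.mul (hfs.mul (hpow _))).circleIntegrable hR.le

open Metric in
theorem circleIntegral_mul_inv_pow_of_mem_ball {f : ℂ → ℂ} {c w : ℂ} {R : ℝ} (hR : 0 < R)
    (hf : AnalyticOnNhd ℂ f (closedBall c R)) (hw : w ∈ ball c R) (j : ℕ) :
    (∮ z in C(c, R), f z * ((z - w) ^ (j + 1))⁻¹) =
      2 * Real.pi * Complex.I * (iteratedDeriv j f w / (j.factorial : ℂ)) := by
  induction j generalizing f with
  | zero =>
    have := hf.differentiableOn.circleIntegral_sub_inv_smul hw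
    simpa [mul_comm] using this
  | succ j ih =>
    have hw' : w ∉ sphere c R := fun h => (mem_ball.mp hw).ne (mem_sphere.mp h)
    rw [circleIntegral_mul_inv_pow_succ hR hf hw', ih hf.deriv, ← iteratedDeriv_succ',
      Nat.factorial_succ]
    have := Nat.cast_add_one_ne_zero (R := ℂ) j
    push_cast
    field_simp

open Metric in
theorem circleIntegral_mul_inv_pow_of_notMem_closedBall {f : ℂ → ℂ} {c w : ℂ} {R : ℝ} (hR : 0 < R)
    (hf : AnalyticOnNhd ℂ f (closedBall c R)) (hw : w ∉ closedBall c R) (j : ℕ) :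
    (∮ z in C(c, R), f z * ((z - w) ^ (j + 1))⁻¹) = 0 := by
  apply DiffContOnCl.circleIntegral_eq_zero hR.le
  apply DifferentiableOn.diffContOnCl
  rw [closure_ball c hR.ne']
  refine hf.differentiableOn.mul (DifferentiableOn.inv (by fun_prop) fun z hz => ?_)
  exact pow_ne_zero _ (sub_ne_zero.mpr fun h => hw (h ▸ hz))

/-! ### Jet sums and the Hermite–Genocchi bound -/

theorem analyticAt_iteratedDeriv {g : ℂ → ℂ} {z : ℂ} (hg : AnalyticAt ℂ g z) (n : ℕ) :
    AnalyticAt ℂ (iteratedDeriv n g) z := by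
  induction n with
  | zero => simpa using hg
  | succ n ih => rw [iteratedDeriv_succ]; exact ih.deriv

/-- Leibniz's rule. For n = 0 the truncated index n - 1 is harmless, its factor n being 0. -/
theorem iteratedDeriv_sub_const_mul {g : ℂ → ℂ} {z : ℂ} (hg : AnalyticAt ℂ g z) (c : ℂ) (n : ℕ) :
    iteratedDeriv n (fun w => (w - c) * g w) z =
      (z - c) * iteratedDeriv n g z + n * iteratedDeriv (n - 1) g z := by
  induction n generalizing z with
  | zero => simp
  | succ n ih =>
    have hd : ∀ m, HasDerivAt (iteratedDeriv m g) (iteratedDeriv (m + 1) g z) z := fun m => by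
      rw [iteratedDeriv_succ]
      exact (analyticAt_iteratedDeriv hg m).differentiableAt.hasDerivAt
    rw [iteratedDeriv_succ,
      Filter.EventuallyEq.deriv_eq (hg.eventually_analyticAt.mono fun w hw => ih hw)]
    have := (((hasDerivAt_id z).sub_const c).mul (hd n)).add ((hd (n - 1)).const_mul (n : ℂ))
    refine this.deriv.trans ?_
    rcases n with _ | n
    · simp [add_comm]
    · simp only [id, Nat.add_sub_cancel]
      push_cast
      ring

/-- The sum of `τ ^ j * g⁽ʲ⁾(κ + τ s)` over `s ∈ S` and `j < m`, weighted by the coefficients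
`C s j`. -/
noncomputable def jetSum {E : Type*} [AddCommGroup E] [Module ℂ E] (S : Finset ℂ) (m : ℕ)
    (C : ℂ → ℕ → E) (g : ℂ → ℂ) (κ τ : ℂ) : E :=
  ∑ s ∈ S, ∑ j ∈ Finset.range m, (τ ^ j * iteratedDeriv j g (κ + τ * s)) • C s j

theorem map_jetSum {E F : Type*} [AddCommGroup E] [Module ℂ E] [AddCommGroup F] [Module ℂ F]
    (l : E →ₗ[ℂ] F) (S : Finset ℂ) (m : ℕ) (C : ℂ → ℕ → E) (g : ℂ → ℂ) (κ τ : ℂ) :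
    l (jetSum S m C g κ τ) = jetSum S m (fun s j => l (C s j)) g κ τ := by
  simp [jetSum, map_sum]

theorem iteratedDeriv_iteratedDeriv_eq (i j : ℕ) (g : ℂ → ℂ) :
    iteratedDeriv i (iteratedDeriv j g) = iteratedDeriv (i + j) g := by
  simp only [iteratedDeriv_eq_iterate, Function.iterate_add_apply]

/-- One step of Hermite–Genocchi, with the integral over x ∈ [0, 1] replaced by a mean value
inequality. The weights τ^j are what make the jets follow the affine contraction towards c. -/
theorem norm_jetSum_iteratedDeriv_le {U : Set ℂ} (hU : IsOpen U) (hUc : Convex ℝ U)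
    {S : Finset ℂ} {m : ℕ} {C : ℂ → ℕ → ℂ} {φ g : ℂ → ℂ} (hg : AnalyticOnNhd ℂ g U)
    {c : ℂ} (hc : c ∈ U) (hφ : ∀ z ∈ U, φ z = (z - c) * g z) {κ τ : ℂ}
    (hS : ∀ s ∈ S, κ + τ * s ∈ U) (k : ℕ) {M : ℝ}
    (hM : ∀ x ∈ Set.Icc (0 : ℝ) 1,
      ‖jetSum S m C (iteratedDeriv (k + 1) φ) (c + x * (κ - c)) (x * τ)‖ ≤ M) :
    ‖jetSum S m C (iteratedDeriv k g) κ τ‖ ≤ M / (k + 1) := by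
  have hmem : ∀ s ∈ S, ∀ x ∈ Set.Icc (0 : ℝ) 1, c + x * (κ + τ * s - c) ∈ U := by
    intro s hs x hx
    have := hUc.add_smul_sub_mem hc (hS s hs) hx
    simpa using this
  -- Jet version of x^(k+1) g⁽ᵏ⁾(c + x(w - c)): it vanishes at x = 0 and is the quantity to bound at
  -- x = 1.
  set Y : ℝ → ℂ := fun x => ∑ s ∈ S, ∑ j ∈ Finset.range m,
    (τ ^ j * ((x : ℂ) ^ (j + k + 1) * iteratedDeriv (j + k) g (c + x * (κ + τ * s - c)))) * C s j
    with hY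
  have hderiv : ∀ x ∈ Set.Icc (0 : ℝ) 1, HasDerivAt Y ((x : ℂ) ^ k *
      jetSum S m C (iteratedDeriv (k + 1) φ) (c + x * (κ - c)) (x * τ)) x := by
    intro x hx
    simp only [jetSum, Finset.mul_sum]
    refine HasDerivAt.fun_sum fun s hs => HasDerivAt.fun_sum fun j _ => ?_
    have hz := hmem s hs x hx
    have harg : c + (x : ℂ) * (κ - c) + x * τ * s = c + x * (κ + τ * s - c) := by ring
    have hφd : iteratedDeriv (j + (k + 1)) φ (c + x * (κ + τ * s - c)) =
        x * (κ + τ * s - c) * iteratedDeriv (j + k + 1) g (c + x * (κ + τ * s - c)) +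
        (j + k + 1) * iteratedDeriv (j + k) g (c + x * (κ + τ * s - c)) := by
      rw [Filter.EventuallyEq.iteratedDeriv_eq (j + (k + 1))
        (Filter.eventually_of_mem (hU.mem_nhds hz) hφ : φ =ᶠ[nhds _] fun z => (z - c) * g z),
        iteratedDeriv_sub_const_mul (hg _ hz)]
      rw [add_sub_cancel_left]
      simp [add_assoc]
    rw [iteratedDeriv_iteratedDeriv_eq, harg, hφd]
    have hgd : HasDerivAt (iteratedDeriv (j + k) g)
        (iteratedDeriv (j + k + 1) g (c + x * (κ + τ * s - c))) (c + x * (κ + τ * s - c)) := by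
      rw [iteratedDeriv_succ]
      exact (analyticAt_iteratedDeriv (hg _ hz) (j + k)).differentiableAt.hasDerivAt
    have hlin : HasDerivAt (fun y : ℂ => c + y * (κ + τ * s - c)) (κ + τ * s - c) (x : ℂ) := by
      simpa using ((hasDerivAt_id (x : ℂ)).mul_const (κ + τ * s - c)).const_add c
    have hcomp := HasDerivAt.comp (x : ℂ) (h₂ := iteratedDeriv (j + k) g) hgd hlin
    have := ((((hasDerivAt_pow (j + k + 1) (x : ℂ)).mul hcomp).const_mul (τ ^ j)).mul_const
      (C s j)).comp_ofReal
    refine this.congr_deriv ?_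
    simp only [Function.comp, Nat.add_sub_cancel, smul_eq_mul]
    push_cast
    ring
  have hB : ∀ x : ℝ, HasDerivAt (fun x : ℝ => M / (k + 1) * x ^ (k + 1)) (M * x ^ k) x := by
    intro x
    refine ((hasDerivAt_pow (k + 1) x).const_mul (M / (k + 1))).congr_deriv ?_
    have : (k : ℝ) + 1 ≠ 0 := Nat.cast_add_one_ne_zero k
    push_cast
    field_simp
  -- Compare ‖Y‖ with M x^(k+1)/(k+1), whose derivative M x^k dominates ‖Y'‖.
  have hbound := image_norm_le_of_norm_deriv_right_le_deriv_boundary' (a := 0) (b := 1)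
    (fun x hx => (hderiv x hx).continuousAt.continuousWithinAt)
    (fun x hx => (hderiv x (Set.Ico_subset_Icc_self hx)).hasDerivWithinAt)
    (B := fun x : ℝ => M / (k + 1) * x ^ (k + 1)) (B' := fun x => M * x ^ k)
    (by simp [hY])
    (fun x _ => (hB x).continuousAt.continuousWithinAt)
    (fun x _ => (hB x).hasDerivWithinAt)
    (fun x hx => by
      rw [norm_mul, norm_pow, Complex.norm_real, Real.norm_of_nonneg hx.1, mul_comm]
      exact mul_le_mul_of_nonneg_right (hM x (Set.Ico_subset_Icc_self hx)) (pow_nonneg hx.1 k))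
    (Set.right_mem_Icc.mpr zero_le_one)
  simpa [hY, jetSum, iteratedDeriv_iteratedDeriv_eq] using hbound

theorem analyticOrderAt_sub_const (c w : ℂ) :
    analyticOrderAt (fun z => z - c) w = if w = c then 1 else 0 := by
  split_ifs with h
  · subst h
    rw [show (1 : ℕ∞) = ((1 : ℕ) : ℕ∞) by simp]
    refine ((by fun_prop : AnalyticAt ℂ (fun z => z - w) w).analyticOrderAt_eq_natCast).mpr
      ⟨fun _ => 1, analyticAt_const, one_ne_zero, by simp⟩
  · exact analyticOrderAt_eq_zero.mpr (Or.inr (sub_ne_zero.mpr h))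

/-- A function that vanishes at the points of `L`, counted with multiplicities, is divisible by the
node polynomial of `L`, and the quotient obeys the Hermite–Genocchi bound. -/
theorem exists_quotient_norm_jetSum_le {U : Set ℂ} (hU : IsOpen U) (hUc : Convex ℝ U)
    {S : Finset ℂ} {m : ℕ} {C : ℂ → ℕ → ℂ} {K : Set ℂ} (hK : Convex ℝ K) (hKne : K.Nonempty)
    (hKU : K ⊆ U) (hSU : ∀ s ∈ S, s ∈ U) (L : Multiset ℂ) (hL : ∀ c ∈ L, c ∈ K)
    {φ : ℂ → ℂ} (hφ : AnalyticOnNhd ℂ φ U)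
    (hord : ∀ w ∈ U, (L.count w : ℕ∞) ≤ analyticOrderAt φ w) :
    ∃ G : ℂ → ℂ, AnalyticOnNhd ℂ G U ∧
      (∀ w ∈ U, φ w = (L.map fun c => w - c).prod * G w) ∧
      ∀ M : ℝ, (∀ t ∈ Set.Icc (0 : ℝ) 1, ∀ μ ∈ K,
        ‖jetSum S m C (iteratedDeriv (Multiset.card L) φ) ((1 - t) * μ) t‖ ≤ M) →
        ‖jetSum S m C G 0 1‖ ≤ M / (Multiset.card L).factorial := by
  induction L using Multiset.induction_on generalizing φ with
  | empty =>
    obtain ⟨μ, hμ⟩ := hKne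
    refine ⟨φ, hφ, by simp, fun M hM => ?_⟩
    -- At t = 1 the point μ drops out, so any μ ∈ K serves.
    simpa using hM 1 (by simp) μ hμ
  | cons c L ih =>
    have hcK : c ∈ K := hL c (Multiset.mem_cons_self c L)
    have hcU := hKU hcK
    have hφc : φ c = 0 := by
      by_contra h
      have := hord c hcU
      rw [analyticOrderAt_eq_zero.mpr (Or.inr h)] at this
      simp at this
    set g := dslope φ c
    have hg : AnalyticOnNhd ℂ g U :=
      ((Complex.differentiableOn_dslope (hU.mem_nhds hcU)).mpr
        hφ.differentiableOn).analyticOnNhd hU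
    have hfac : ∀ z, φ z = (z - c) * g z := fun z => by
      have := sub_smul_dslope φ c z
      rw [hφc, sub_zero, smul_eq_mul] at this
      exact this.symm
    have hgord : ∀ w ∈ U, (L.count w : ℕ∞) ≤ analyticOrderAt g w := by
      intro w hw
      have h1 := hord w hw
      have h2 : analyticOrderAt φ w = (if w = c then 1 else 0) + analyticOrderAt g w := by
        rw [← analyticOrderAt_sub_const, ← analyticOrderAt_mul (by fun_prop) (hg w hw)]
        congr 1
        exact funext hfac
      rw [h2, Multiset.count_cons] at h1
      split_ifs at h1 with h
      · rw [add_comm, Nat.cast_add, Nat.cast_one] at h1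
        exact (ENat.add_le_add_iff_left (by simp)).mp h1
      · simpa using h1
    obtain ⟨G, hG, hGfac, hGb⟩ := ih (fun a ha => hL a (Multiset.mem_cons_of_mem ha)) hg hgord
    refine ⟨G, hG, fun w hw => ?_, fun M hM => ?_⟩
    · rw [hfac, hGfac w hw, Multiset.map_cons, Multiset.prod_cons, mul_assoc]
    · have hstep := hGb (M / (Multiset.card L + 1)) fun t ht μ hμ => by
        refine norm_jetSum_iteratedDeriv_le hU hUc hg hcU (fun z _ => hfac z)
          (fun s hs => ?_) _ fun x hx => ?_
        · have := hUc (hKU hμ) (hSU s hs) (sub_nonneg.mpr ht.2) ht.1 (sub_add_cancel 1 t)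
          simpa using this
        -- The weights 1 - x of c and x(1 - t) of μ add up to 1 - xt; ν is their normalised
        -- combination. If xt = 1 both weights vanish and ν is arbitrary.
        · obtain ⟨ν, hν, hνe⟩ : ∃ ν ∈ K, (1 - ((x * t : ℝ) : ℂ)) * ν =
              c + x * ((1 - t) * μ - c) := by
            rcases eq_or_ne (x * t) 1 with h1 | h1
            · have hx1 : x = 1 := le_antisymm hx.2 (by nlinarith [hx.1, hx.2, ht.1, ht.2])
              have ht1 : t = 1 := by simpa [hx1] using h1
              exact ⟨c, hcK, by simp [hx1, ht1]⟩
            · have hlt : x * t < 1 := lt_of_le_of_ne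
                (mul_le_one₀ hx.2 ht.1 ht.2) h1
              have hpos : 0 < 1 - x * t := sub_pos.mpr hlt
              refine ⟨((1 - x) / (1 - x * t)) • c + ((x * (1 - t)) / (1 - x * t)) • μ,
                hK hcK hμ (div_nonneg (sub_nonneg.mpr hx.2) hpos.le)
                  (div_nonneg (mul_nonneg hx.1 (sub_nonneg.mpr ht.2)) hpos.le) ?_, ?_⟩
              · field_simp
                ring
              · have : (1 : ℂ) - x * t ≠ 0 := by exact_mod_cast hpos.ne'
                simp only [Complex.real_smul]
                push_cast
                field_simp
                ring
          have := hM (x * t) ⟨mul_nonneg hx.1 ht.1, mul_le_one₀ hx.2 ht.1 ht.2⟩ ν hν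
          rw [hνe, Multiset.card_cons] at this
          simpa using this
      rw [Multiset.card_cons, Nat.factorial_succ]
      refine hstep.trans_eq ?_
      push_cast
      rw [div_div]

/-! ### Contours and spectral resolutions -/

theorem finite_spectrum_matrix {n : ℕ} (A : Matrix (Fin n) (Fin n) ℂ) :
    (spectrum ℂ A).Finite := by
  have : spectrum ℂ A ⊆ (A.charpoly.roots.toFinset : Set ℂ) := fun l hl => by
    simpa [A.charpoly_monic.ne_zero] using Matrix.mem_spectrum_iff_isRoot_charpoly.mp hl
  exact (Finset.finite_toSet _).subset this

theorem exists_enclosesSpectrum {n : ℕ} {f : ℂ → ℂ} {A : Matrix (Fin n) (Fin n) ℂ}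
    (hf : ∀ l ∈ spectrum ℂ A, AnalyticAt ℂ f l) :
    ∃ Γ : Finset (ℂ × ℝ), EnclosesSpectrum Γ f A := by
  classical
  have hfin := finite_spectrum_matrix A
  have h1 : ∀ᶠ r in nhdsWithin (0 : ℝ) (Set.Ioi 0), ∀ l ∈ spectrum ℂ A,
      AnalyticOnNhd ℂ f (Metric.closedBall l r) := by
    refine (Filter.eventually_all_finite hfin).mpr fun l hl => ?_
    obtain ⟨ε, hε, hb⟩ := Metric.nhds_basis_closedBall.eventually_iff.mp
      (hf l hl).eventually_analyticAt
    filter_upwards [Ioo_mem_nhdsGT hε] with r hr z hz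
    exact hb (Metric.closedBall_subset_closedBall hr.2.le hz)
  have h2 : ∀ᶠ r in nhdsWithin (0 : ℝ) (Set.Ioi 0), ∀ l ∈ spectrum ℂ A, ∀ l' ∈ spectrum ℂ A,
      l ≠ l' → Disjoint (Metric.closedBall l r) (Metric.closedBall l' r) := by
    refine (Filter.eventually_all_finite hfin).mpr fun l _ =>
      (Filter.eventually_all_finite hfin).mpr fun l' _ => ?_
    rcases eq_or_ne l l' with h | h
    · simp [h]
    · filter_upwards [Ioo_mem_nhdsGT (half_pos (dist_pos.mpr h))] with r hr _
      exact Metric.closedBall_disjoint_closedBall (by linarith [hr.2])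
  obtain ⟨r, ⟨hr1, hr2⟩, hr⟩ := ((h1.and h2).and self_mem_nhdsWithin).exists
  refine ⟨hfin.toFinset.image fun l => (l, r), ?_, ?_, ?_, ?_⟩
  · simp only [Finset.mem_image]
    rintro p ⟨l, -, rfl⟩
    exact hr
  · simp only [Finset.mem_image, Set.Finite.mem_toFinset]
    rintro p ⟨l, hl, rfl⟩ q ⟨l', hl', rfl⟩ hne
    exact hr2 l hl l' hl' fun h => hne (by rw [h])
  · simp only [Finset.mem_image, Set.Finite.mem_toFinset]
    rintro p ⟨l, hl, rfl⟩
    exact hr1 l hl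
  · intro l hl
    exact ⟨(l, r), Finset.mem_image_of_mem _ (hfin.mem_toFinset.mpr hl), Metric.mem_ball_self hr⟩

/-- A decomposition of the identity into matrices `P s` annihilated by `(A - s) ^ n`, for `s` in a
finite set `S` of eigenvalues of `A`. -/
structure IsSpectralResolution {n : ℕ} (A : Matrix (Fin n) (Fin n) ℂ) (S : Finset ℂ)
    (P : ℂ → Matrix (Fin n) (Fin n) ℂ) : Prop where
  mem_spectrum : ∀ s ∈ S, s ∈ spectrum ℂ A
  sum_eq_one : ∑ s ∈ S, P s = 1
  pow_mul_eq_zero : ∀ s ∈ S, (A - s • (1 : Matrix (Fin n) (Fin n) ℂ)) ^ n * P s = 0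

/-- Bézout for the pairwise coprime (X - s)^n, followed by Cayley–Hamilton. The uniform exponent n
exceeds no bound needed later and avoids tracking multiplicities. -/
theorem exists_isSpectralResolution {n : ℕ} (A : Matrix (Fin n) (Fin n) ℂ) :
    ∃ S P, IsSpectralResolution A S P := by
  classical
  rcases Nat.eq_zero_or_pos n with rfl | hn
  · exact ⟨∅, 0, by simp, Subsingleton.elim _ _, by simp⟩
  set S := A.charpoly.roots.toFinset with hS
  have hdeg : A.charpoly.natDegree = n := by simp
  have hcard : Multiset.card A.charpoly.roots = n := by
    rw [← (IsAlgClosed.splits A.charpoly).natDegree_eq_card_roots, hdeg]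
  have hne : S.Nonempty := by
    rw [hS, Multiset.toFinset_nonempty, ← Multiset.card_pos, hcard]
    exact hn
  obtain ⟨a, ha⟩ := (exists_sum_eq_one_iff_pairwise_coprime
    (s := fun s : ℂ => (Polynomial.X - Polynomial.C s) ^ n) hne).mpr fun i j hij =>
      (Polynomial.isCoprime_X_sub_C_of_isUnit_sub
        (sub_ne_zero.mpr fun h => hij (Subtype.ext h)).isUnit).pow
  have hdvd : A.charpoly ∣ ∏ s ∈ S, (Polynomial.X - Polynomial.C s) ^ n := by
    rw [(IsAlgClosed.splits A.charpoly).eq_prod_roots_of_monic A.charpoly_monic,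
      Finset.prod_multiset_map_count]
    refine Finset.prod_dvd_prod_of_dvd _ _ fun s _ => pow_dvd_pow _ ?_
    exact (Multiset.count_le_card s _).trans hcard.le
  refine ⟨S, fun s => Polynomial.aeval A (a s * ∏ j ∈ S \ {s}, (Polynomial.X - Polynomial.C j) ^ n),
    fun s hs => ?_, ?_, fun s hs => ?_⟩
  · rw [hS, Multiset.mem_toFinset] at hs
    exact Matrix.mem_spectrum_iff_isRoot_charpoly.mpr (Polynomial.isRoot_of_mem_roots hs)
  · rw [← map_sum, ha, map_one]
  · have hA : A - s • (1 : Matrix (Fin n) (Fin n) ℂ) =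
        Polynomial.aeval A (Polynomial.X - Polynomial.C s) := by
      simp [Algebra.algebraMap_eq_smul_one]
    rw [hA, ← map_pow, ← map_mul, mul_left_comm, 
      ← Finset.prod_eq_mul_prod_sdiff_singleton_of_mem hs
        (fun j => (Polynomial.X - Polynomial.C j) ^ n)]
    obtain ⟨q, hq⟩ := hdvd
    rw [hq, map_mul, map_mul, Matrix.aeval_self_charpoly, zero_mul, mul_zero]

/-- The coefficients `(A - s) ^ j P s / j!` of the matrix function of `A` in terms of jets. -/
noncomputable def jetCoeff {n : ℕ} (A : Matrix (Fin n) (Fin n) ℂ)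
    (P : ℂ → Matrix (Fin n) (Fin n) ℂ) (s : ℂ) (j : ℕ) : Matrix (Fin n) (Fin n) ℂ :=
  (j.factorial : ℂ)⁻¹ • ((A - s • (1 : Matrix (Fin n) (Fin n) ℂ)) ^ j * P s)

/-! ### Matrix functions as jet sums -/

namespace IsSpectralResolution

variable {n : ℕ} {A : Matrix (Fin n) (Fin n) ℂ} {S : Finset ℂ}
  {P : ℂ → Matrix (Fin n) (Fin n) ℂ}

theorem mem_spectrum_affine (h : IsSpectralResolution A S P) (κ τ : ℂ) {s : ℂ} (hs : s ∈ S) :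
    κ + τ * s ∈ spectrum ℂ (κ • (1 : Matrix (Fin n) (Fin n) ℂ) + τ • A) := by
  have hA := h.mem_spectrum s hs
  rw [spectrum.mem_iff] at hA ⊢
  intro hu
  apply hA
  have he : algebraMap ℂ (Matrix (Fin n) (Fin n) ℂ) (κ + τ * s) - (κ • 1 + τ • A) =
      algebraMap ℂ _ τ * (algebraMap ℂ _ s - A) := by
    simp only [Algebra.algebraMap_eq_smul_one, add_smul, mul_smul, smul_mul_assoc, one_mul,
      smul_sub]
    abel
  rw [he] at hu
  exact ((Commute.isUnit_mul_iff (Algebra.commutes τ _)).mp hu).2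

/-- Partial fractions of the resolvent: on each P s the Neumann series in A - s stops before the
power n. -/
theorem sub_affine_mul (h : IsSpectralResolution A S P) {κ τ z : ℂ}
    (hz : ∀ s ∈ S, z - (κ + τ * s) ≠ 0) :
    (z • (1 : Matrix (Fin n) (Fin n) ℂ) - (κ • 1 + τ • A)) *
      ∑ s ∈ S, ∑ j ∈ Finset.range n, (τ ^ j * ((z - (κ + τ * s)) ^ (j + 1))⁻¹) •
        ((A - s • (1 : Matrix (Fin n) (Fin n) ℂ)) ^ j * P s) = 1 := by
  rw [Finset.mul_sum, ← h.sum_eq_one]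
  refine Finset.sum_congr rfl fun s hs => ?_
  have ha := hz s hs
  set a := z - (κ + τ * s) with ha'
  set B := A - s • (1 : Matrix (Fin n) (Fin n) ℂ) with hB
  have h1 : z • (1 : Matrix (Fin n) (Fin n) ℂ) - (κ • 1 + τ • A) = a • (1 - (τ / a) • B) := by
    rw [smul_sub, smul_smul, mul_div_cancel₀ _ ha, hB, ha', smul_sub, smul_smul]
    module
  have h2 : ∑ j ∈ Finset.range n, (τ ^ j * (a ^ (j + 1))⁻¹) • (B ^ j * P s) =
      a⁻¹ • ((∑ j ∈ Finset.range n, ((τ / a) • B) ^ j) * P s) := by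
    rw [Finset.sum_mul, Finset.smul_sum]
    refine Finset.sum_congr rfl fun j _ => ?_
    rw [smul_pow, smul_mul_assoc, smul_smul]
    rw [div_pow, pow_succ']
    congr 1
    field_simp
  rw [h.sum_eq_one, h1, h2, smul_mul_smul_comm, mul_inv_cancel₀ ha, one_smul, ← mul_assoc,
    mul_neg_geom_sum, sub_mul, one_mul, smul_pow, smul_mul_assoc, h.pow_mul_eq_zero s hs, smul_zero,
    sub_zero]

theorem exists_eq_of_mem_spectrum_affine (h : IsSpectralResolution A S P) {κ τ l : ℂ}
    (hl : l ∈ spectrum ℂ (κ • (1 : Matrix (Fin n) (Fin n) ℂ) + τ • A)) :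
    ∃ s ∈ S, l = κ + τ * s := by
  by_contra! hne
  rw [spectrum.mem_iff, Algebra.algebraMap_eq_smul_one] at hl
  exact hl (IsUnit.of_mul_eq_one _ (h.sub_affine_mul fun s hs => sub_ne_zero.mpr (hne s hs)))

/-- Integrate the partial fractions termwise by Cauchy's formula. The result does not involve Γ, so
the choice of contour in `matrixFunction` is immaterial. -/
theorem resolventIntegral_affine (h : IsSpectralResolution A S P) {f : ℂ → ℂ} {κ τ : ℂ}
    {Γ : Finset (ℂ × ℝ)} (hΓ : EnclosesSpectrum Γ f (κ • 1 + τ • A)) :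
    resolventIntegral Γ f (κ • 1 + τ • A) = jetSum S n (jetCoeff A P) f κ τ := by
  have hpi : (2 * Real.pi * Complex.I : ℂ) ≠ 0 := Complex.two_pi_I_ne_zero
  -- Disjointness of the discs makes each eigenvalue count exactly once.
  have hloc : ∀ s ∈ S, ∃ p ∈ Γ, κ + τ * s ∈ Metric.ball p.1 p.2 ∧
      ∀ q ∈ Γ, q ≠ p → κ + τ * s ∉ Metric.closedBall q.1 q.2 := fun s hs => by
    obtain ⟨p, hp, hm⟩ := hΓ.encloses _ (h.mem_spectrum_affine κ τ hs)
    exact ⟨p, hp, hm, fun q hq hne hmq => Set.disjoint_left.mp (hΓ.disjoint q hq p hp hne) hmq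
      (Metric.ball_subset_closedBall hm)⟩
  have hsphere : ∀ s ∈ S, ∀ q ∈ Γ, κ + τ * s ∉ Metric.sphere q.1 q.2 := fun s hs q hq hm => by
    obtain ⟨p, hp, hb, ho⟩ := hloc s hs
    rcases eq_or_ne q p with rfl | hne
    · exact (Metric.mem_ball.mp hb).ne (Metric.mem_sphere.mp hm)
    · exact ho q hq hne (Metric.sphere_subset_closedBall hm)
  have hsum : ∀ s ∈ S, ∀ j, ∑ q ∈ Γ, (∮ z in C(q.1, q.2), f z * ((z - (κ + τ * s)) ^ (j + 1))⁻¹) =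
      2 * Real.pi * Complex.I * (iteratedDeriv j f (κ + τ * s) / (j.factorial : ℂ)) := by
    intro s hs j
    obtain ⟨p, hp, hb, ho⟩ := hloc s hs
    rw [Finset.sum_eq_single_of_mem p hp fun q hq hne =>
      circleIntegral_mul_inv_pow_of_notMem_closedBall (hΓ.radius_pos q hq) (hΓ.analytic q hq)
        (ho q hq hne) j]
    exact circleIntegral_mul_inv_pow_of_mem_ball (hΓ.radius_pos p hp) (hΓ.analytic p hp) hb j
  ext i k
  have hint : ∀ q ∈ Γ, (∮ z in C(q.1, q.2),
      f z * (z • (1 : Matrix (Fin n) (Fin n) ℂ) - (κ • 1 + τ • A))⁻¹ i k) =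
      ∑ s ∈ S, ∑ j ∈ Finset.range n,
        τ ^ j * ((A - s • (1 : Matrix (Fin n) (Fin n) ℂ)) ^ j * P s) i k *
          ∮ z in C(q.1, q.2), f z * ((z - (κ + τ * s)) ^ (j + 1))⁻¹ := by
    intro q hq
    have hne : ∀ s ∈ S, ∀ z ∈ Metric.sphere q.1 q.2, z - (κ + τ * s) ≠ 0 := fun s hs z hz h0 =>
      hsphere s hs q hq (sub_eq_zero.mp h0 ▸ hz)
    have hcont : ∀ s ∈ S, ∀ j : ℕ, CircleIntegrable
        (fun z => τ ^ j * ((A - s • (1 : Matrix (Fin n) (Fin n) ℂ)) ^ j * P s) i k *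
          (f z * ((z - (κ + τ * s)) ^ (j + 1))⁻¹)) q.1 q.2 := fun s hs j => by
      refine ContinuousOn.circleIntegrable (hΓ.radius_pos q hq).le ?_
      refine continuousOn_const.mul
        (((hΓ.analytic q hq).continuousOn.mono Metric.sphere_subset_closedBall).mul ?_)
      exact ContinuousOn.inv₀ (by fun_prop) fun z hz => pow_ne_zero _ (hne s hs z hz)
    rw [circleIntegral.integral_congr (hΓ.radius_pos q hq).le (g := fun z =>
      ∑ s ∈ S, ∑ j ∈ Finset.range n,
        τ ^ j * ((A - s • (1 : Matrix (Fin n) (Fin n) ℂ)) ^ j * P s) i k *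
          (f z * ((z - (κ + τ * s)) ^ (j + 1))⁻¹)), circleIntegral.integral_fun_sum]
    · refine Finset.sum_congr rfl fun s hs => ?_
      rw [circleIntegral.integral_fun_sum fun j _ => hcont s hs j]
      simp only [circleIntegral.integral_const_mul]
    · intro s hs
      exact CircleIntegrable.fun_sum _ fun j _ => hcont s hs j
    · intro z hz
      simp only [Matrix.inv_eq_right_inv (h.sub_affine_mul fun s hs => hne s hs z hz), Matrix.sum_apply, Matrix.smul_apply,
        smul_eq_mul, Finset.mul_sum]
      refine Finset.sum_congr rfl fun s _ => Finset.sum_congr rfl fun j _ => ?_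
      ring
  simp only [resolventIntegral, Matrix.of_apply, jetSum, Matrix.sum_apply, Matrix.smul_apply,
    jetCoeff, smul_eq_mul]
  rw [Finset.sum_congr rfl hint, Finset.sum_comm, Finset.mul_sum]
  refine Finset.sum_congr rfl fun s hs => ?_
  rw [Finset.sum_comm, Finset.mul_sum]
  refine Finset.sum_congr rfl fun j _ => ?_
  rw [← Finset.mul_sum, hsum s hs j]
  field_simp

theorem matrixFunction_affine (h : IsSpectralResolution A S P) {f : ℂ → ℂ} {κ τ : ℂ}
    (hf : ∀ l ∈ spectrum ℂ (κ • (1 : Matrix (Fin n) (Fin n) ℂ) + τ • A), AnalyticAt ℂ f l) :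
    matrixFunction f (κ • 1 + τ • A) = jetSum S n (jetCoeff A P) f κ τ := by
  have hex := exists_enclosesSpectrum hf
  rw [matrixFunction, dif_pos hex]
  exact h.resolventIntegral_affine hex.choose_spec

theorem matrixFunction_eq (h : IsSpectralResolution A S P) {f : ℂ → ℂ}
    (hf : ∀ l ∈ spectrum ℂ A, AnalyticAt ℂ f l) :
    matrixFunction f A = jetSum S n (jetCoeff A P) f 0 1 := by
  have h0 : (0 : ℂ) • (1 : Matrix (Fin n) (Fin n) ℂ) + (1 : ℂ) • A = A := by simp
  have := h.matrixFunction_affine (f := f) (κ := 0) (τ := 1) (by rwa [h0])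
  rwa [h0] at this

end IsSpectralResolution

/-! ### Multiplicativity of the functional calculus -/

section jetSum

variable {E : Type*} [AddCommGroup E] [Module ℂ E] {S : Finset ℂ} {m : ℕ} {C : ℂ → ℕ → E}
  {g₁ g₂ : ℂ → ℂ}

theorem jetSum_congr {κ τ : ℂ} (h : ∀ s ∈ S, g₁ =ᶠ[nhds (κ + τ * s)] g₂) :
    jetSum S m C g₁ κ τ = jetSum S m C g₂ κ τ := by
  refine Finset.sum_congr rfl fun s hs => Finset.sum_congr rfl fun j _ => ?_
  simp [(h s hs).iteratedDeriv_eq j]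

theorem jetSum_add (h₁ : ∀ s ∈ S, AnalyticAt ℂ g₁ s) (h₂ : ∀ s ∈ S, AnalyticAt ℂ g₂ s) :
    jetSum S m C (fun z => g₁ z + g₂ z) 0 1 = jetSum S m C g₁ 0 1 + jetSum S m C g₂ 0 1 := by
  simp only [jetSum, ← Finset.sum_add_distrib]
  refine Finset.sum_congr rfl fun s hs => Finset.sum_congr rfl fun j _ => ?_
  simp [iteratedDeriv_fun_add (h₁ s hs).contDiffAt (h₂ s hs).contDiffAt, add_smul]

theorem jetSum_sub (h₁ : ∀ s ∈ S, AnalyticAt ℂ g₁ s) (h₂ : ∀ s ∈ S, AnalyticAt ℂ g₂ s) :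
    jetSum S m C (fun z => g₁ z - g₂ z) 0 1 = jetSum S m C g₁ 0 1 - jetSum S m C g₂ 0 1 := by
  simp only [jetSum, ← Finset.sum_sub_distrib]
  refine Finset.sum_congr rfl fun s hs => Finset.sum_congr rfl fun j _ => ?_
  simp [iteratedDeriv_fun_sub (h₁ s hs).contDiffAt (h₂ s hs).contDiffAt, sub_smul]

theorem jetSum_const_mul (a : ℂ) :
    jetSum S m C (fun z => a * g₁ z) 0 1 = a • jetSum S m C g₁ 0 1 := by
  simp only [jetSum, Finset.smul_sum]
  refine Finset.sum_congr rfl fun s hs => Finset.sum_congr rfl fun j _ => ?_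
  simp [iteratedDeriv_const_mul_field, mul_smul]

end jetSum

namespace IsSpectralResolution

variable {n : ℕ} {A : Matrix (Fin n) (Fin n) ℂ} {S : Finset ℂ}
  {P : ℂ → Matrix (Fin n) (Fin n) ℂ} {g : ℂ → ℂ}

/-- Write A = s + (A - s). The factor A - s shifts j by one, matching the Leibniz term j g⁽ʲ⁻¹⁾;
both boundary terms of the shift vanish. -/
theorem mul_jetSum (h : IsSpectralResolution A S P) (hg : ∀ s ∈ S, AnalyticAt ℂ g s) :
    A * jetSum S n (jetCoeff A P) g 0 1 = jetSum S n (jetCoeff A P) (fun z => z * g z) 0 1 := by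
  simp only [jetSum, Finset.mul_sum]
  refine Finset.sum_congr rfl fun s hs => ?_
  set B := A - s • (1 : Matrix (Fin n) (Fin n) ℂ) with hB
  set T : ℕ → Matrix (Fin n) (Fin n) ℂ := fun j =>
    (j * iteratedDeriv (j - 1) g s) • jetCoeff A P s j with hT
  have hTn : T n = 0 := by simp [hT, jetCoeff, h.pow_mul_eq_zero s hs]
  have hT0 : T 0 = 0 := by simp [hT]
  have hTsum : ∑ j ∈ Finset.range n, T (j + 1) = ∑ j ∈ Finset.range n, T j := by
    have h1 := Finset.sum_range_succ T n
    rw [Finset.sum_range_succ', hTn, hT0] at h1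
    simpa using h1
  have hderiv : ∀ j, iteratedDeriv j (fun z => z * g z) s =
      s * iteratedDeriv j g s + j * iteratedDeriv (j - 1) g s := fun j => by
    simpa using iteratedDeriv_sub_const_mul (hg s hs) 0 j
  have hBT : ∀ j, B * (iteratedDeriv j g s • jetCoeff A P s j) = T (j + 1) := fun j => by
    have hj : ((j : ℂ) + 1) ≠ 0 := Nat.cast_add_one_ne_zero j
    simp only [hT, jetCoeff, ← hB, mul_smul_comm, smul_smul, pow_succ', mul_assoc,
      Nat.factorial_succ, Nat.add_sub_cancel]
    congr 1
    push_cast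
    field_simp
  calc ∑ j ∈ Finset.range n, A * ((1 ^ j * iteratedDeriv j g (0 + 1 * s)) • jetCoeff A P s j)
      = ∑ j ∈ Finset.range n, ((s * iteratedDeriv j g s) • jetCoeff A P s j + T (j + 1)) := by
        refine Finset.sum_congr rfl fun j _ => ?_
        rw [← hBT, one_pow, one_mul, one_mul, zero_add]
        set Z := iteratedDeriv j g s • jetCoeff A P s j with hZ
        rw [mul_smul, ← hZ, hB, sub_mul, smul_mul_assoc, one_mul]
        abel
    _ = _ := by
        rw [Finset.sum_add_distrib, hTsum, ← Finset.sum_add_distrib]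
        refine Finset.sum_congr rfl fun j _ => ?_
        rw [one_pow, one_mul, one_mul, zero_add, hderiv, add_smul]

theorem aeval_mul_jetSum (h : IsSpectralResolution A S P) (p : Polynomial ℂ)
    (hg : ∀ s ∈ S, AnalyticAt ℂ g s) :
    Polynomial.aeval A p * jetSum S n (jetCoeff A P) g 0 1 =
      jetSum S n (jetCoeff A P) (fun z => p.eval z * g z) 0 1 := by
  induction p using Polynomial.induction_on generalizing g with
  | C a => simp [jetSum_const_mul, Algebra.algebraMap_eq_smul_one]
  | add p q hp hq =>
    have ha : ∀ r : Polynomial ℂ, ∀ s ∈ S, AnalyticAt ℂ (fun z => r.eval z * g z) s :=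
      fun r s hs => r.differentiable.analyticAt s |>.mul (hg s hs)
    simp only [map_add, add_mul, hp hg, hq hg, Polynomial.eval_add]
    rw [jetSum_add (ha p) (ha q)]
  | monomial k a hk =>
    rw [pow_succ, ← mul_assoc, map_mul, Polynomial.aeval_X, mul_assoc, h.mul_jetSum hg,
      hk (g := fun z => z * g z) fun s hs => analyticAt_id.mul (hg s hs)]
    simp [mul_assoc]

end IsSpectralResolution

/-! ### Interpolation, error formula and conclusion -/

theorem isUnit_aeval_of_eval_ne_zero {n : ℕ} {A : Matrix (Fin n) (Fin n) ℂ} {v : Polynomial ℂ}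
    (hv : ∀ l ∈ spectrum ℂ A, v.eval l ≠ 0) : IsUnit (Polynomial.aeval A v) := by
  rcases Nat.eq_zero_or_pos n with rfl | hn
  · exact isUnit_of_subsingleton _
  have : Nonempty (Fin n) := ⟨⟨0, hn⟩⟩
  by_contra hu
  have h0 : (0 : ℂ) ∈ spectrum ℂ (Polynomial.aeval A v) := spectrum.zero_mem_iff ℂ |>.mpr hu
  rw [spectrum.map_polynomial_aeval_of_nonempty A v
    (spectrum.nonempty_of_isAlgClosed_of_finiteDimensional ℂ A)] at h0
  obtain ⟨l, hl, h⟩ := h0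
  exact hv l hl h

theorem iteratedDeriv_polynomial_eval (p : Polynomial ℂ) (k : ℕ) :
    iteratedDeriv k (fun w => p.eval w) = fun w => (Polynomial.derivative^[k] p).eval w := by
  induction k generalizing p with
  | zero => simp
  | succ k ih =>
    rw [iteratedDeriv_succ', Function.iterate_succ_apply, ← ih]
    congr 1
    exact funext fun w => p.deriv

theorem count_map_univ_eq_nodeMultiplicity {N : ℕ} (z : Fin N → ℂ) (w : ℂ) :
    (Multiset.map z Finset.univ.val).count w = nodeMultiplicity z w := by
  classical
  rw [Multiset.count_map, nodeMultiplicity, Nat.card_eq_fintype_card, Fintype.card_subtype]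
  simp [Finset.card, eq_comm]

/-- Near a node v f - u = v (f - r), and v does not vanish there. -/
theorem Interpolates.nodeMultiplicity_le_analyticOrderAt {N : ℕ} {z : Fin N → ℂ} {f : ℂ → ℂ}
    {u v : Polynomial ℂ} (hr : Interpolates (ratioFun u v) f z) (k : Fin N)
    (hf : AnalyticAt ℂ f (z k)) (hv : v.eval (z k) ≠ 0) :
    (nodeMultiplicity z (z k) : ℕ∞) ≤
      analyticOrderAt (fun w => v.eval w * f w - u.eval w) (z k) := by
  have hva : AnalyticAt ℂ (fun w => v.eval w) (z k) := v.differentiable.analyticAt _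
  have hra : AnalyticAt ℂ (ratioFun u v) (z k) := (u.differentiable.analyticAt _).div hva hv
  have heq : (fun w => v.eval w * f w - u.eval w) =ᶠ[nhds (z k)]
      (fun w => v.eval w) * (fun w => f w - ratioFun u v w) := by
    filter_upwards [hva.continuousAt.eventually_ne hv] with w hw
    simp only [Pi.mul_apply, ratioFun]
    field_simp
  rw [analyticOrderAt_congr heq, analyticOrderAt_mul hva (hf.fun_sub hra)]
  refine le_trans ?_ le_add_self
  rw [natCast_le_analyticOrderAt_iff_iteratedDeriv_eq_zero (hf.fun_sub hra)]
  intro j hj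
  rw [iteratedDeriv_fun_sub hf.contDiffAt hra.contDiffAt, hr k j hj, sub_self]

theorem continuousOn_jetSum_affine {S : Finset ℂ} {m : ℕ} {C : ℂ → ℕ → ℂ} {V K : Set ℂ}
    {g : ℂ → ℂ} (hg : AnalyticOnNhd ℂ g V)
    (hV : ∀ t ∈ Set.Icc (0 : ℝ) 1, ∀ μ ∈ K, ∀ s ∈ S, (1 - (t : ℂ)) * μ + t * s ∈ V) :
    ContinuousOn (fun p : ℝ × ℂ => jetSum S m C g ((1 - (p.1 : ℂ)) * p.2) p.1)
      (Set.Icc (0 : ℝ) 1 ×ˢ K) := by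
  refine continuousOn_finsetSum _ fun s hs => continuousOn_finsetSum _ fun j _ => ?_
  have hgj : ContinuousOn (iteratedDeriv j g) V := fun x hx =>
    (analyticAt_iteratedDeriv (hg x hx) j).continuousAt.continuousWithinAt
  have hpow : Continuous fun p : ℝ × ℂ => (p.1 : ℂ) ^ j := by fun_prop
  refine (hpow.continuousOn.mul ?_).smul continuousOn_const
  exact hgj.comp (f := fun p : ℝ × ℂ => (1 - (p.1 : ℂ)) * p.2 + p.1 * s) (by fun_prop) fun p hp => hV p.1 hp.1 p.2 hp.2 s hs

/-- The linear functional `X ↦ dᴴ R X b`. -/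
noncomputable def sandwichLinear {n : ℕ} (R : Matrix (Fin n) (Fin n) ℂ) (d b : Fin n → ℂ) :
    Matrix (Fin n) (Fin n) ℂ →ₗ[ℂ] ℂ where
  toFun X := sandwich d (R * X) b
  map_add' X Y := by simp [sandwich, mul_add, Matrix.add_mulVec, dotProduct_add]
  map_smul' a X := by simp [sandwich, Matrix.smul_mulVec, dotProduct_smul]

/-- Both v(A) (f(A) - r(A)) and ω(A) G(A) are the jet sum of v f - u; then cancel v(A), which
commutes with ω(A). -/
theorem IsSpectralResolution.matrixFunction_sub_matrixFunction_ratioFun {n : ℕ}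
    {A : Matrix (Fin n) (Fin n) ℂ} {S : Finset ℂ} {P : ℂ → Matrix (Fin n) (Fin n) ℂ}
    (hS : IsSpectralResolution A S P) {V : Set ℂ} (hV : IsOpen V) (hAV : spectrum ℂ A ⊆ V)
    {f G : ℂ → ℂ} (hf : AnalyticOnNhd ℂ f V) (hG : AnalyticOnNhd ℂ G V) {u v ω : Polynomial ℂ}
    (hv : ∀ l ∈ spectrum ℂ A, v.eval l ≠ 0)
    (hfac : ∀ w ∈ V, v.eval w * f w - u.eval w = ω.eval w * G w) :
    matrixFunction f A - matrixFunction (ratioFun u v) A =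
      Polynomial.aeval A ω * (Polynomial.aeval A v)⁻¹ * jetSum S n (jetCoeff A P) G 0 1 := by
  have hpa : ∀ (p : Polynomial ℂ) (s : ℂ), AnalyticAt ℂ (fun w => p.eval w) s := fun p s =>
    p.differentiable.analyticAt s
  have hra : ∀ l ∈ spectrum ℂ A, AnalyticAt ℂ (ratioFun u v) l := fun l hl =>
    (hpa u l).div (hpa v l) (hv l hl)
  have hfa : ∀ l ∈ spectrum ℂ A, AnalyticAt ℂ f l := fun l hl => hf l (hAV hl)
  have hfS := fun s hs => hfa s (hS.mem_spectrum s hs)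
  have hrS := fun s hs => hra s (hS.mem_spectrum s hs)
  have hGS : ∀ s ∈ S, AnalyticAt ℂ G s := fun s hs => hG s (hAV (hS.mem_spectrum s hs))
  have hunit := (Matrix.isUnit_iff_isUnit_det _).mp (isUnit_aeval_of_eval_ne_zero hv)
  have hmul : Polynomial.aeval A v * (matrixFunction f A - matrixFunction (ratioFun u v) A) =
      Polynomial.aeval A ω * jetSum S n (jetCoeff A P) G 0 1 := by
    rw [hS.matrixFunction_eq hfa, hS.matrixFunction_eq hra, ← jetSum_sub hfS hrS,
      hS.aeval_mul_jetSum v fun s hs => (hfS s hs).fun_sub (hrS s hs), hS.aeval_mul_jetSum ω hGS]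
    refine jetSum_congr fun s hs => ?_
    rw [zero_add, one_mul]
    have hsA := hS.mem_spectrum s hs
    filter_upwards [hV.mem_nhds (hAV hsA),
      (hpa v s).continuousAt.eventually_ne (hv s hsA)] with w hw hvw
    rw [← hfac w hw, ratioFun]
    field_simp
  have hcomm : Polynomial.aeval A v * Polynomial.aeval A ω =
      Polynomial.aeval A ω * Polynomial.aeval A v := by
    rw [← map_mul, mul_comm, map_mul]
  have hcomm' : (Polynomial.aeval A v)⁻¹ * Polynomial.aeval A ω =
      Polynomial.aeval A ω * (Polynomial.aeval A v)⁻¹ := by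
    calc _ = (Polynomial.aeval A v)⁻¹ * (Polynomial.aeval A ω * Polynomial.aeval A v) *
          (Polynomial.aeval A v)⁻¹ := by
          rw [mul_assoc, mul_assoc, Matrix.mul_nonsing_inv _ hunit, mul_one]
      _ = _ := by rw [← hcomm, ← mul_assoc, Matrix.nonsing_inv_mul _ hunit, one_mul]
  rw [← hcomm', mul_assoc, ← hmul, ← mul_assoc, Matrix.nonsing_inv_mul _ hunit, one_mul]

theorem corollaryc {n N : ℕ} (hN : 0 < N)
    (A : Matrix (Fin n) (Fin n) ℂ) (z : Fin N → ℂ)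
    (U : Set ℂ) (hU : IsOpen U)
    (hsub : convexHull ℝ (spectrum ℂ A ∪ Set.range z) ⊆ U)
    (f : ℂ → ℂ) (hf : AnalyticOnNhd ℂ f U)
    (u v : Polynomial ℂ) (hu : u.natDegree ≤ N - 1)
    (hvz : ∀ k : Fin N, v.eval (z k) ≠ 0)
    (hvA : ∀ l ∈ spectrum ℂ A, v.eval l ≠ 0)
    (hr : Interpolates (ratioFun u v) f z)
    (b d : Fin n → ℂ) :
    IsUnit (Polynomial.aeval A v) ∧
    ∃ M : ℝ,
      IsGreatest
        ((fun p : ℝ × ℂ => ‖sandwich d (remainderMatrix A z f v p.1 p.2) b‖) ''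
          (Set.Icc (0 : ℝ) 1 ×ˢ convexHull ℝ (Set.range z))) M ∧
      ‖sandwich d (matrixFunction f A - matrixFunction (ratioFun u v) A) b‖ ≤ M := by
  refine ⟨isUnit_aeval_of_eval_ne_zero hvA, ?_⟩
  obtain ⟨S, P, hS⟩ := exists_isSpectralResolution A
  -- U need not be convex; a thin thickening of the compact hull is open, convex and inside U.
  obtain ⟨δ, hδ, hδU⟩ := (((finite_spectrum_matrix A).union
    (Set.finite_range z)).isCompact_convexHull ℝ).exists_thickening_subset_open hU hsub
  set H := convexHull ℝ (spectrum ℂ A ∪ Set.range z)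
  set V := Metric.thickening δ H
  set K := convexHull ℝ (Set.range z)
  have hV : IsOpen V := Metric.isOpen_thickening
  have hVc : Convex ℝ V := (convex_convexHull ℝ _).thickening δ
  have hHV : H ⊆ V := Metric.self_subset_thickening hδ H
  have hKV : K ⊆ V := (convexHull_mono Set.subset_union_right).trans hHV
  have hAV : spectrum ℂ A ⊆ V :=
    (Set.subset_union_left.trans (subset_convexHull ℝ _)).trans hHV
  have hzK : ∀ k, z k ∈ K := fun k => subset_convexHull ℝ _ (Set.mem_range_self k)
  have hfV : AnalyticOnNhd ℂ f V := hf.mono hδU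
  have hKne : K.Nonempty := ⟨z ⟨0, hN⟩, hzK _⟩
  have hmem : ∀ t ∈ Set.Icc (0 : ℝ) 1, ∀ μ ∈ K, ∀ s ∈ S, (1 - (t : ℂ)) * μ + t * s ∈ V := by
    intro t ht μ hμ s hs
    have := hVc (hKV hμ) (hAV (hS.mem_spectrum s hs)) (sub_nonneg.mpr ht.2) ht.1
      (sub_add_cancel 1 t)
    simpa using this
  have hpa : ∀ p : Polynomial ℂ, AnalyticOnNhd ℂ (fun w => p.eval w) V := fun p s _ =>
    p.differentiable.analyticAt s
  set h : ℂ → ℂ := fun w => v.eval w * f w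
  have hh : AnalyticOnNhd ℂ h V := (hpa v).mul hfV
  have hhN : AnalyticOnNhd ℂ (iteratedDeriv N h) V := fun w hw =>
    analyticAt_iteratedDeriv (hh w hw) N
  set L : Multiset ℂ := Multiset.map z Finset.univ.val with hL
  have hLcard : Multiset.card L = N := by simp [hL]
  set l := sandwichLinear (Polynomial.aeval A (nodePolynomial z) * (Polynomial.aeval A v)⁻¹) d b
  obtain ⟨G, hG, hGfac, hGb⟩ := exists_quotient_norm_jetSum_le hV hVc (S := S) (m := n)
    (C := fun s j => l (jetCoeff A P s j)) (convex_convexHull ℝ (Set.range z)) hKne hKV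
    (fun s hs => hAV (hS.mem_spectrum s hs)) L
    (fun c hc => by
      obtain ⟨k, -, rfl⟩ := Multiset.mem_map.mp hc
      exact hzK k)
    (φ := fun w => h w - u.eval w) (hh.sub (hpa u))
    (fun w _ => by
      by_cases hw : w ∈ Set.range z
      · obtain ⟨k, rfl⟩ := hw
        rw [hL, count_map_univ_eq_nodeMultiplicity]
        exact hr.nodeMultiplicity_le_analyticOrderAt k (hfV _ (hKV (hzK k))) (hvz k)
      · have : L.count w = 0 := Multiset.count_eq_zero.mpr fun hm => by
          obtain ⟨k, -, hk⟩ := Multiset.mem_map.mp hm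
          exact hw ⟨k, hk⟩
        simp [this])
  have hrem : ∀ t ∈ Set.Icc (0 : ℝ) 1, ∀ μ ∈ K, sandwich d (remainderMatrix A z f v t μ) b =
      (N.factorial : ℂ)⁻¹ * jetSum S n (fun s j => l (jetCoeff A P s j)) (iteratedDeriv N h)
        ((1 - (t : ℂ)) * μ) t := by
    intro t ht μ hμ
    rw [← map_jetSum, ← hS.matrixFunction_affine, ← smul_eq_mul, ← map_smul]
    · rfl
    · intro w hw
      obtain ⟨s, hs, rfl⟩ := hS.exists_eq_of_mem_spectrum_affine hw
      exact hhN _ (hmem t ht μ hμ s hs)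
  have hcont : ContinuousOn
      (fun p : ℝ × ℂ => ‖sandwich d (remainderMatrix A z f v p.1 p.2) b‖)
      (Set.Icc (0 : ℝ) 1 ×ˢ K) :=
    (((continuousOn_jetSum_affine (m := n) (C := fun s j => l (jetCoeff A P s j)) hhN hmem).const_smul ((N.factorial : ℂ)⁻¹)).norm).congr
      fun p hp => congrArg norm (hrem p.1 hp.1 p.2 hp.2)
  obtain ⟨p, hp, hmax⟩ := (isCompact_Icc.prod
    ((Set.finite_range z).isCompact_convexHull ℝ)).exists_isMaxOn
    ((Set.nonempty_Icc.mpr zero_le_one).prod hKne) hcont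
  refine ⟨_, ⟨⟨p, hp, rfl⟩, ?_⟩, ?_⟩
  · rintro _ ⟨q, hq, rfl⟩
    exact isMaxOn_iff.mp hmax q hq
  set M := ‖sandwich d (remainderMatrix A z f v p.1 p.2) b‖
  have hfact : (0 : ℝ) < N.factorial := by exact_mod_cast N.factorial_pos
  -- The factor N! offsets the one in `remainderMatrix`.
  have hbound := hGb (N.factorial * M) fun t ht μ hμ => by
    have hle : ‖sandwich d (remainderMatrix A z f v t μ) b‖ ≤ M :=
      isMaxOn_iff.mp hmax (t, μ) ⟨ht, hμ⟩
    rw [hrem t ht μ hμ, norm_mul, norm_inv, Complex.norm_natCast, inv_mul_le_iff₀ hfact] at hle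
    rw [hLcard]
    -- The N-th derivative of u is zero, as deg u ≤ N - 1 and N > 0.
    have hjet : jetSum S n (fun s j => l (jetCoeff A P s j))
        (iteratedDeriv N fun w => h w - u.eval w) ((1 - (t : ℂ)) * μ) t =
        jetSum S n (fun s j => l (jetCoeff A P s j)) (iteratedDeriv N h) ((1 - (t : ℂ)) * μ) t := by
      refine jetSum_congr fun s hs => ?_
      filter_upwards [hV.mem_nhds (hmem t ht μ hμ s hs)] with w hw
      rw [iteratedDeriv_fun_sub (hh w hw).contDiffAt (hpa u w hw).contDiffAt,
        iteratedDeriv_polynomial_eval,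
        Polynomial.iterate_derivative_eq_zero (by omega)]
      simp
    rwa [hjet]
  rw [hLcard, mul_div_cancel_left₀ _ hfact.ne', ← map_jetSum] at hbound
  rw [hS.matrixFunction_sub_matrixFunction_ratioFun hV hAV hfV hG hvA
    (ω := nodePolynomial z) fun w hw => ?_]
  · exact hbound
  · refine (hGfac w hw).trans ?_
    rw [hL, Multiset.map_map, nodePolynomial, Polynomial.eval_prod]
    simp only [Polynomial.eval_sub, Polynomial.eval_X, Polynomial.eval_C]
    rfl
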